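/- Let $k$ be a field. Let $w=xyyyx\cdots$ be the right-infinite word with first letter $x$ that is fixed by the morphism $x\mapsto xy$, $y\mapsto yyx$, and let $w'$ be the right-infinite word obtained from $w$ by the substitutions $x\mapsto x'$, $y\mapsto y'$. For a right-infinite word $v=a_1a_2a_3\cdots$ put $v[i,j]=a_i\cdots a_j$. Call a sequence of integers $0=n_0<n_1<n_2<\cdots$ \emph{universal} if for every finite sequence $(a_1,\dots,a_s)$ of positive integers there is $m\ge 0$ with $a_j=n_{m+j}-n_{m+j-1}$ for $j=1,\dots,s$. Given a universal sequence, put $$\tilde w=w[1,n_1]\,w'[n_1+1,n_2]\,w[n_2+1,n_3]\,w'[n_3+1,n_4]\cdots,$$ and let $A=k\langle x,y,x',y'\rangle/I$, where $I$ is the two-sided ideal generated by all words that do not occur as a (contiguous) subword of $\tilde w$. For $d\ge 0$ let $A_d$ be the span of the images of the words of degree $d$, where $\deg x=\deg x'=1$ and $\deg y=\deg y'=2$. The positive part $\bigoplus_{d\ge1}A_d$ of a graded algebra $A=\bigoplus_{d\ge 0}A_d$ is called graded nilpotent if, for every $d\ge 1$ and every set $S\subseteq A_d$, the (non-unital) subalgebra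 $B$ generated by $S$ is nilpotent, i.e. $B^N=0$ for some $N$. A monomial algebra is a quotient of a free algebra by a two-sided ideal generated by words. \textbf{Theorem.} (1) Universal sequences exist. (2) For every universal sequence, the subspaces $A_d$ define a grading $A=\bigoplus_{d\ge0}A_d$ of the algebra $A$ constructed above, the positive part of $A$ is graded nilpotent, and the elements $x+y$ and $x'+y'$ of $A$ freely generate a free subalgebra of $A$. (3) Consequently, there is a finitely generated monomial algebra over $k$, graded by giving each generator degree $1$ or $2$ (and hence generated as an algebra by its components of degrees $1$ and $2$), whose positive part is graded nilpotent and contains two elements that freely generate a free subalgebra. -/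

import Mathlib

namespace FreeSubalgebra

/-! ### Finite and right-infinite words -/

/-- For a right-infinite word `v = v 0, v 1, v 2, …`, the finite word `v i, v (i+1), …, v (j-1)`.
In one-based indexing this is the word consisting of the letters number `i + 1` to `j`. -/
def segment {α : Type*} (v : ℕ → α) (i j : ℕ) : List α :=
  (List.range (j - i)).map fun t => v (i + t)

/-- The finite word `u` occurs as a (contiguous, possibly empty) subword of `v`. -/
def IsSubword {α : Type*} (u : List α) (v : ℕ → α) : Prop :=
  ∃ i j : ℕ, u = segment v i j

/-- The endomorphism of the free monoid on `α` determined by the images of the letters. -/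
def substitute {α : Type*} (f : α → List α) (u : List α) : List α :=
  u.flatMap f

/-! ### The fixed point of `x ↦ xy`, `y ↦ yyx` -/

/-- The two-letter alphabet. -/
inductive Letter : Type
  | x : Letter
  | y : Letter

/-- The images of the letters under the morphism `x ↦ xy`, `y ↦ yyx`. -/
def letterImage : Letter → List Letter
  | Letter.x => [Letter.x, Letter.y]
  | Letter.y => [Letter.y, Letter.y, Letter.x]

/-- The finite word obtained by applying the morphism `m` times to the letter `x`. -/
def iterateWord (m : ℕ) : List Letter :=
  (substitute letterImage)^[m] [Letter.x]

/-- The right-infinite word `w = xyyyx…` fixed by `x ↦ xy`, `y ↦ yyx`.  Its `i`-th letter is the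
`i`-th letter of the `i`-th iterate, which is long enough (`lt_length_iterateWord`), so that the
default value is never used. -/
def fixedWord (i : ℕ) : Letter :=
  (iterateWord i).getD i Letter.x

theorem iterateWord_succ (m : ℕ) :
    iterateWord (m + 1) = substitute letterImage (iterateWord m) := by
  simp only [iterateWord, Function.iterate_succ_apply']

theorem iterateWord_succ_eq (m : ℕ) : ∃ s : List Letter, s ≠ [] ∧
    iterateWord (m + 1) = iterateWord m ++ s := by
  induction m with
  | zero => exact ⟨[Letter.y], by simp, rfl⟩
  | succ m ih =>
    obtain ⟨s, hs, h⟩ := ih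
    refine ⟨substitute letterImage s, ?_, ?_⟩
    · cases s with
      | nil => exact absurd rfl hs
      | cons a t => cases a <;> simp [substitute, letterImage]
    · rw [iterateWord_succ (m + 1)]
      nth_rewrite 1 [h]
      rw [substitute, List.flatMap_append, ← substitute, ← iterateWord_succ m, ← substitute]

theorem lt_length_iterateWord (m : ℕ) : m < (iterateWord m).length := by
  induction m with
  | zero => simp [iterateWord]
  | succ m ih =>
    obtain ⟨s, hs, h⟩ := iterateWord_succ_eq m
    have := List.length_pos_iff.2 hs
    rw [h, List.length_append]
    omega

theorem iterateWord_prefix {m n : ℕ} (h : m ≤ n) : iterateWord m <+: iterateWord n := by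
  induction n, h using Nat.le_induction with
  | base => exact List.prefix_rfl
  | succ n _ ih =>
    obtain ⟨s, -, hs⟩ := iterateWord_succ_eq n
    exact ih.trans ⟨s, hs.symm⟩

theorem getElem?_iterateWord {m i : ℕ} (h : i < (iterateWord m).length) :
    (iterateWord m)[i]? = some (fixedWord i) := by
  have key : (iterateWord m)[i]? = (iterateWord i)[i]? := by
    rcases le_total m i with hm | hm
    · obtain ⟨s, hs⟩ := iterateWord_prefix hm
      rw [← hs, List.getElem?_append_left h]
    · obtain ⟨s, hs⟩ := iterateWord_prefix hm
      rw [← hs, List.getElem?_append_left (lt_length_iterateWord i)]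
  rw [key, fixedWord, List.getD_eq_getElem?_getD,
    List.getElem?_eq_getElem (lt_length_iterateWord i), Option.getD_some]

/-- Every iterate of the morphism on the letter `x` is a prefix of `fixedWord`. -/
theorem iterateWord_eq_segment (m : ℕ) :
    iterateWord m = segment fixedWord 0 (iterateWord m).length := by
  apply List.ext_getElem?
  intro i
  by_cases h : i < (iterateWord m).length
  · rw [getElem?_iterateWord h]
    simp [segment, h]
  · rw [List.getElem?_eq_none (by omega), List.getElem?_eq_none (by simp [segment]; omega)]

/-- `fixedWord` is fixed by the morphism: the image of every prefix is again a prefix. -/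
theorem substitute_segment_fixedWord (m : ℕ) :
    substitute letterImage (segment fixedWord 0 m) =
      segment fixedWord 0 (substitute letterImage (segment fixedWord 0 m)).length := by
  have mono : ∀ {a b : ℕ}, a ≤ b → segment fixedWord 0 a <+: segment fixedWord 0 b := by
    intro a b hab
    obtain ⟨c, rfl⟩ := Nat.exists_eq_add_of_le hab
    simp only [segment, Nat.sub_zero, List.range_add, List.map_append]
    exact List.prefix_append _ _
  obtain ⟨s, hs⟩ := mono (lt_length_iterateWord m).le
  rw [← iterateWord_eq_segment] at hs
  have h1 : substitute letterImage (segment fixedWord 0 m) <+: iterateWord (m + 1) := by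
    rw [iterateWord_succ, ← hs]
    simp only [substitute, List.flatMap_append]
    exact List.prefix_append _ _
  have h2 := mono h1.length_le
  rw [← iterateWord_eq_segment] at h2
  exact (List.prefix_of_prefix_length_le h1 h2 (by simp [segment])).eq_of_length
    (by simp [segment])

/-! ### Splicing -/

/-- A sequence `0 = n 0 < n 1 < n 2 < …` such that every finite sequence of positive integers
occurs as a block of consecutive terms of the sequence of gaps `n (m + 1) - n m`. -/
structure HasUniversalGaps (n : ℕ → ℕ) : Prop where
  zero : n 0 = 0
  strictMono : StrictMono n
  realizes : ∀ a : List ℕ, (∀ t ∈ a, 0 < t) →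
    ∃ m : ℕ, ∀ (j : ℕ) (hj : j < a.length), n (m + j + 1) = n (m + j) + a[j]

open Classical in
/-- The right-infinite word obtained by splicing alternate blocks of `v` and `v'`: for
`0 = n 0 < n 1 < …` it agrees with `v` at the positions `i` with `n m ≤ i < n (m + 1)`, `m` even,
and with `v'` at the positions `i` with `n m ≤ i < n (m + 1)`, `m` odd. -/
noncomputable def splice {α : Type*} (n : ℕ → ℕ) (v v' : ℕ → α) (i : ℕ) : α :=
  if ∃ m : ℕ, Even m ∧ n m ≤ i ∧ i < n (m + 1) then v i else v' i

theorem segment_splice {α : Type*} {n : ℕ → ℕ} (hn : StrictMono n) (v v' : ℕ → α) (m : ℕ) :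
    segment (splice n v v') (n m) (n (m + 1)) =
      if Even m then segment v (n m) (n (m + 1)) else segment v' (n m) (n (m + 1)) := by
  have key : ∀ t < n (m + 1) - n m, ((∃ l : ℕ, Even l ∧ n l ≤ n m + t ∧ n m + t < n (l + 1)) ↔
      Even m) := by
    intro t ht
    constructor
    · rintro ⟨l, hl, h1, h2⟩
      have a1 : l < m + 1 := hn.lt_iff_lt.1 (by omega)
      have a2 : m < l + 1 := hn.lt_iff_lt.1 (by omega)
      have : l = m := by omega
      exact this ▸ hl
    · intro hm
      exact ⟨m, hm, by omega, by omega⟩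
  split_ifs with hm
  · refine List.map_congr_left fun t ht => ?_
    rw [splice, if_pos ((key t (List.mem_range.1 ht)).2 hm)]
  · refine List.map_congr_left fun t ht => ?_
    rw [splice, if_neg (fun h => hm ((key t (List.mem_range.1 ht)).1 h))]

/-- The four-letter alphabet `x, y, x', y'`. -/
inductive Alphabet : Type
  | x : Alphabet
  | y : Alphabet
  | xPrime : Alphabet
  | yPrime : Alphabet

/-- The inclusion of `x, y` in the four-letter alphabet. -/
def unprimed : Letter → Alphabet
  | Letter.x => Alphabet.x
  | Letter.y => Alphabet.y

/-- The substitution of the primed letters for `x, y`. -/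
def primed : Letter → Alphabet
  | Letter.x => Alphabet.xPrime
  | Letter.y => Alphabet.yPrime

/-- The word obtained by splicing alternate blocks of the fixed word and its primed copy. -/
noncomputable def splicedWord (n : ℕ → ℕ) : ℕ → Alphabet :=
  splice n (fun i => unprimed (fixedWord i)) (fun i => primed (fixedWord i))

/-- The degrees of the letters: one for `x, x'` and two for `y, y'`. -/
def letterDegree : Alphabet → ℕ
  | Alphabet.x => 1
  | Alphabet.y => 2
  | Alphabet.xPrime => 1
  | Alphabet.yPrime => 2

/-! ### Monomial algebras -/

/-- The monomial of the free algebra given by a finite word. -/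
noncomputable def freeMonomial (k : Type*) [Field k] {α : Type*} (u : List α) :
    FreeAlgebra k α :=
  (u.map (FreeAlgebra.ι k)).prod

/-- The relations `u = 0` for the words `u` in the set `F`. -/
inductive MonomialRel (k : Type*) [Field k] {α : Type*} (F : Set (List α)) :
    FreeAlgebra k α → FreeAlgebra k α → Prop
  | of (u : List α) (hu : u ∈ F) : MonomialRel k F (freeMonomial k u) 0

/-- The monomial algebra with generators `α` and forbidden words `F`: the quotient of the free
(unital, associative) algebra by the two-sided ideal generated by the monomials in `F`. -/
abbrev MonomialAlgebra (k : Type*) [Field k] {α : Type*} (F : Set (List α)) : Type _ :=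
  RingQuot (MonomialRel k F)

/-- The image in the monomial algebra of the monomial given by a finite word. -/
noncomputable def monomialOf (k : Type*) [Field k] {α : Type*} (F : Set (List α)) (u : List α) :
    MonomialAlgebra k F :=
  RingQuot.mkAlgHom k (MonomialRel k F) (freeMonomial k u)

/-- The grading of a monomial algebra in which the generator `a` has degree `deg a`: the component
of degree `d` is spanned by the monomials of degree `d`. -/
def monomialGrading (k : Type*) [Field k] {α : Type*} (F : Set (List α)) (deg : α → ℕ) (d : ℕ) :
    Submodule k (MonomialAlgebra k F) :=
  Submodule.span k {a | ∃ u : List α, (u.map deg).sum = d ∧ a = monomialOf k F u}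

/-- The words that do not occur as subwords of `v`.  The monomial algebra with this set of
forbidden words is the monomial algebra of the right-infinite word `v`. -/
def nonSubwords {α : Type*} (v : ℕ → α) : Set (List α) :=
  {u | ¬ IsSubword u v}

/-! ### Graded nilpotence and free subalgebras -/

/-- The positive part `⨁_{d ≥ 1} 𝒜 d` of the graded algebra `A = ⨁_{d ≥ 0} 𝒜 d` is graded
nilpotent: for every `d ≥ 1` and every set `S` of homogeneous elements of degree `d`, the
(non-unital) algebra `B` generated by `S` is nilpotent, that is, `B ^ N = 0` for some `N`. -/
def PositivePartIsGradedNilpotent {k A : Type*} [Field k] [Ring A] [Algebra k A]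
    (𝒜 : ℕ → Submodule k A) : Prop :=
  ∀ d : ℕ, 1 ≤ d → ∀ S : Set A, S ⊆ 𝒜 d →
    IsNilpotent (NonUnitalAlgebra.adjoin k S).toSubmodule

/-- The elements `a` and `b` generate a free subalgebra, with free generators `a` and `b`: the
homomorphism from the free algebra on two generators that sends these to `a` and `b` is
injective. -/
def GenerateFreeSubalgebra (k : Type*) {A : Type*} [Field k] [Ring A] [Algebra k A]
    (a b : A) : Prop :=
  Function.Injective (FreeAlgebra.lift k ![a, b] : FreeAlgebra k (Fin 2) →ₐ[k] A)

end FreeSubalgebra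

open FreeSubalgebra

/-!
Write `w` for the fixed word and `A` for the monomial algebra of the spliced word.

**Graded nilpotence.** The `N`-th power of the algebra generated by elements of degree `d` lies in
the span of the products of at least `N` monomials of degree `d`
(`positivePartIsGradedNilpotent_of_bound`). So it suffices that no long subword of the spliced word
factors into words of degree `d`. Since primes do not change degrees, this says that the degrees of
the prefixes of `w` contain no long arithmetic progression of difference `d`
(`exists_bound_progression`, `exists_bound_flatten`).

To see this, factor `w` into the images of its letters under the `n`-th power of the morphism. If
`x` and `y` have weights `(a, b)`, their images have weights `(a + b, a + 2b)`. This transformation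
is invertible, hence of finite order modulo `d`, and it maps `(0, 1)` to the degrees `(1, 2)`; so
there is `n` for which the images of `x` and `y` have degrees `0` and `1` modulo `d`
(`exists_iterate_weightStep`). Therefore the degrees at which the images of consecutive letters `y`
start run through all residues modulo `d`. The image of `y` begins with `y`, so the degree following
its start is not the degree of a prefix. As `y` occurs in `w` with bounded gaps, every residue class
modulo `d` meets such a missing degree in every sufficiently long interval.

**Free generation.** Colour the letters by the presence of a prime. A product of copies of `x + y`
and `x' + y'` is the sum of all nonzero monomials with one prescribed colour pattern
(`prod_sum_letterAction`), so distinct products have disjoint supports, and they are independent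
as soon as each is nonzero (`injective_lift_sum_monomialOf`). Universality of the gaps provides,
for each pattern, a subword of the spliced word (`exists_isSubword_splicedWord`). That distinct
nonzero monomials are independent in `A` is seen from its action on functions on words
(`wordAction`).

**Grading.** The relations of a monomial algebra are homogeneous, so the decomposition into
components is an algebra homomorphism defined on generators (`decomposeMonomial`).
-/

namespace FreeSubalgebra

/-! ### Segments of right-infinite words -/

section Segment

variable {α : Type*} (v : ℕ → α)

theorem length_segment (i j : ℕ) : (segment v i j).length = j - i := by
  simp [segment]

theorem segment_append {i j l : ℕ} (hij : i ≤ j) (hjl : j ≤ l) :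
    segment v i j ++ segment v j l = segment v i l := by
  obtain ⟨a, rfl⟩ := Nat.exists_eq_add_of_le hij
  obtain ⟨b, rfl⟩ := Nat.exists_eq_add_of_le hjl
  have h1 : i + a - i = a := by omega
  have h2 : i + a + b - (i + a) = b := by omega
  have h3 : i + a + b - i = a + b := by omega
  simp only [segment, h1, h2, h3, List.range_add, List.map_append, List.map_map]
  congr 1
  refine List.map_congr_left fun t _ => ?_
  simp [add_assoc]

theorem segment_succ (i : ℕ) : segment v i (i + 1) = [v i] := by
  simp [segment]

theorem segment_zero_succ (i : ℕ) : segment v 0 (i + 1) = segment v 0 i ++ [v i] := by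
  rw [← segment_succ, segment_append v (Nat.zero_le i) (Nat.le_succ i)]

theorem map_segment {β : Type*} (f : α → β) (i j : ℕ) :
    (segment v i j).map f = segment (fun t => f (v t)) i j := by
  simp [segment]

/-- A prefix of a segment is the segment of its own length with the same left end. -/
theorem eq_segment_of_append {u s : List α} {i j : ℕ} (h : u ++ s = segment v i j) :
    u = segment v i (i + u.length) := by
  have hl := congrArg List.length h
  rw [List.length_append, length_segment] at hl
  by_cases hu : u.length = 0
  · rw [List.length_eq_zero_iff] at hu
    simp [hu, segment]
  · rw [← segment_append v (Nat.le_add_right i u.length) (by omega)] at h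
    exact List.append_inj_left h (by simp [length_segment])

/-- A suffix of a segment is a segment. -/
theorem IsSubword.of_append {u s : List α} (h : IsSubword (u ++ s) v) : IsSubword s v := by
  obtain ⟨i, j, h⟩ := h
  by_cases hij : i + u.length ≤ j
  · refine ⟨i + u.length, j, ?_⟩
    have h1 := eq_segment_of_append v h
    rw [← segment_append v (Nat.le_add_right i u.length) hij, ← h1] at h
    exact List.append_cancel_left h
  · have hl := congrArg List.length h
    rw [List.length_append, length_segment] at hl
    have : s = [] := List.length_eq_zero_iff.1 (by omega)
    exact ⟨0, 0, by simp [this, segment]⟩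

theorem IsSubword.of_append_left {u s : List α} (h : IsSubword (u ++ s) v) : IsSubword u v := by
  obtain ⟨i, j, h⟩ := h
  exact ⟨_, _, eq_segment_of_append v h⟩

theorem IsSubword.nil : IsSubword [] v := ⟨0, 0, by simp [segment]⟩

end Segment

/-! ### Prefix weights of the fixed word -/

section Weight

variable {M : Type*} [AddCommMonoid M]

/-- The weight of a letter when `x` has weight `p.1` and `y` has weight `p.2`. -/
def letterWeight (p : M × M) : Letter → M
  | Letter.x => p.1
  | Letter.y => p.2

/-- The weight of a word, the sum of the weights of its letters. -/
def wordWeight (p : M × M) (u : List Letter) : M :=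
  (u.map (letterWeight p)).sum

/-- The weights of the words `xy` and `yyx`, the images of the letters. -/
def weightStep (p : M × M) : M × M :=
  (p.1 + p.2, p.2 + (p.2 + p.1))

theorem wordWeight_append (p : M × M) (u v : List Letter) :
    wordWeight p (u ++ v) = wordWeight p u + wordWeight p v := by
  simp [wordWeight]

theorem wordWeight_substitute (p : M × M) (u : List Letter) :
    wordWeight p (substitute letterImage u) = wordWeight (weightStep p) u := by
  induction u with
  | nil => rfl
  | cons a u ih =>
    rw [substitute, List.flatMap_cons, wordWeight_append, ← substitute, ih]
    cases a <;> simp [wordWeight, letterImage, letterWeight, weightStep, add_assoc]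

theorem wordWeight_iterate (n : ℕ) (p : M × M) (u : List Letter) :
    wordWeight p ((substitute letterImage)^[n] u) = wordWeight (weightStep^[n] p) u := by
  induction n generalizing p with
  | zero => rfl
  | succ n ih =>
    rw [Function.iterate_succ_apply', wordWeight_substitute, ih, Function.iterate_succ_apply]

theorem natCast_wordWeight {R : Type*} [Semiring R] (a b : ℕ) (u : List Letter) :
    ((wordWeight (a, b) u : ℕ) : R) = wordWeight ((a : R), (b : R)) u := by
  induction u with
  | nil => simp [wordWeight]
  | cons c u ih =>
    simp only [wordWeight, List.map_cons, List.sum_cons, Nat.cast_add] at ih ⊢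
    rw [ih]
    cases c <;> rfl

end Weight

/-- The transformation of weights induced by the morphism is invertible, so modulo `d` it has
finite order; since it maps `(0, 1)` to `(1, 2)`, some iterate maps `(1, 2)` back to `(0, 1)`. -/
theorem exists_iterate_weightStep (d : ℕ) [NeZero d] :
    ∃ n : ℕ, weightStep^[n] ((1, 2) : ZMod d × ZMod d) = (0, 1) := by
  have inj : Function.Injective (weightStep : ZMod d × ZMod d → ZMod d × ZMod d) := by
    rintro ⟨a, b⟩ ⟨a', b'⟩ h
    simp only [weightStep, Prod.mk.injEq] at h
    obtain ⟨h1, h2⟩ := h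
    have hb : b = b' := by linear_combination h2 - h1
    subst hb
    exact Prod.ext (add_right_cancel h1) rfl
  obtain ⟨p, hp, hper⟩ := inj.mem_periodicPts ((0, 1) : ZMod d × ZMod d)
  obtain ⟨n, rfl⟩ := Nat.exists_eq_succ_of_ne_zero hp.ne'
  refine ⟨n, ?_⟩
  have h := hper.eq
  rw [Function.iterate_succ_apply] at h
  convert h using 2
  simp [weightStep, one_add_one_eq_two]

/-- The degree of the prefix of length `i` of the fixed word, where `deg x = 1`, `deg y = 2`. -/
def prefixDegree (i : ℕ) : ℕ :=
  wordWeight (1, 2) (segment fixedWord 0 i)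

/-- The number of letters `y` in the prefix of length `i` of the fixed word. -/
def prefixCount (i : ℕ) : ℕ :=
  wordWeight (0, 1) (segment fixedWord 0 i)

theorem prefixDegree_succ (i : ℕ) :
    prefixDegree (i + 1) = prefixDegree i + letterWeight (1, 2) (fixedWord i) := by
  rw [prefixDegree, segment_zero_succ, wordWeight_append]
  simp [prefixDegree, wordWeight]

theorem prefixCount_succ (i : ℕ) :
    prefixCount (i + 1) = prefixCount i + letterWeight (0, 1) (fixedWord i) := by
  rw [prefixCount, segment_zero_succ, wordWeight_append]
  simp [prefixCount, wordWeight]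

theorem strictMono_prefixDegree : StrictMono prefixDegree := by
  refine strictMono_nat_of_lt_succ fun i => ?_
  rw [prefixDegree_succ]
  cases fixedWord i <;> simp [letterWeight]

theorem prefixDegree_add_le (i t : ℕ) : prefixDegree (i + t) ≤ prefixDegree i + 2 * t := by
  induction t with
  | zero => simp
  | succ t ih =>
    have h : letterWeight (1, 2) (fixedWord (i + t)) ≤ 2 := by
      cases fixedWord (i + t) <;> simp [letterWeight]
    rw [← add_assoc, prefixDegree_succ]
    omega

/-- A letter `y` at position `i` skips the degree `prefixDegree i + 1`. -/
theorem prefixDegree_ne_of_eq_y {i : ℕ} (hi : fixedWord i = Letter.y) (m : ℕ) :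
    prefixDegree m ≠ prefixDegree i + 1 := by
  intro h
  have h1 : i < m := strictMono_prefixDegree.lt_iff_lt.1 (by omega)
  have h2 := strictMono_prefixDegree.monotone (Nat.succ_le_of_lt h1)
  rw [Nat.succ_eq_add_one, prefixDegree_succ, hi] at h2
  simp only [letterWeight] at h2
  omega

/-! ### Desubstitution of the fixed word -/

theorem iterate_substitute_append (n : ℕ) (u v : List Letter) :
    (substitute letterImage)^[n] (u ++ v) =
      (substitute letterImage)^[n] u ++ (substitute letterImage)^[n] v := by
  induction n generalizing u v with
  | zero => rfl
  | succ n ih =>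
    simp only [Function.iterate_succ_apply, ← ih]
    simp [substitute]

/-- The position in the fixed word at which the image of its letter number `j` under the `n`-th
power of the morphism begins. -/
def blockStart (n j : ℕ) : ℕ :=
  ((substitute letterImage)^[n] (segment fixedWord 0 j)).length

theorem iterate_substitute_segment (n j : ℕ) :
    (substitute letterImage)^[n] (segment fixedWord 0 j) =
      segment fixedWord 0 (blockStart n j) := by
  induction n with
  | zero => simp [blockStart, length_segment]
  | succ n ih =>
    rw [blockStart, Function.iterate_succ_apply', ih]
    exact substitute_segment_fixedWord _

theorem segment_blockStart_succ (n j : ℕ) :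
    segment fixedWord 0 (blockStart n (j + 1)) = segment fixedWord 0 (blockStart n j) ++
      (substitute letterImage)^[n] [fixedWord j] := by
  rw [← iterate_substitute_segment, segment_zero_succ, iterate_substitute_append,
    iterate_substitute_segment]

theorem blockStart_succ (n j : ℕ) : blockStart n (j + 1) =
    blockStart n j + ((substitute letterImage)^[n] [fixedWord j]).length := by
  have h := congrArg List.length (segment_blockStart_succ n j)
  simpa [length_segment] using h

theorem length_iterate_substitute_le (n : ℕ) (u : List Letter) :
    ((substitute letterImage)^[n] u).length ≤ 3 ^ n * u.length := by
  induction n generalizing u with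
  | zero => simp
  | succ n ih =>
    have h : (substitute letterImage u).length ≤ 3 * u.length := by
      induction u with
      | nil => simp [substitute]
      | cons a u ih =>
        rw [substitute, List.flatMap_cons, List.length_append, ← substitute, List.length_cons]
        cases a <;> simp only [letterImage, List.length_cons, List.length_nil] <;> omega
    rw [Function.iterate_succ_apply, pow_succ, mul_assoc]
    exact (ih _).trans (Nat.mul_le_mul_left _ h)

theorem iterate_substitute_letter (n : ℕ) (a : Letter) :
    ∃ s, (substitute letterImage)^[n] [a] = a :: s := by
  induction n with
  | zero => exact ⟨[], rfl⟩
  | succ n ih =>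
    obtain ⟨s, hs⟩ := ih
    rw [Function.iterate_succ_apply', hs]
    cases a <;> exact ⟨_, rfl⟩

theorem blockStart_zero (n : ℕ) : blockStart n 0 = 0 := by
  have := length_iterate_substitute_le n []
  simpa [blockStart, segment] using this

theorem blockStart_succ_le (n j : ℕ) : blockStart n (j + 1) ≤ blockStart n j + 3 ^ n := by
  have := length_iterate_substitute_le n [fixedWord j]
  rw [blockStart_succ]
  simpa using this

theorem strictMono_blockStart (n : ℕ) : StrictMono (blockStart n) := by
  refine strictMono_nat_of_lt_succ fun j => ?_
  obtain ⟨s, hs⟩ := iterate_substitute_letter n (fixedWord j)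
  rw [blockStart_succ, hs]
  simp

theorem blockStart_add_le (n j t : ℕ) : blockStart n (j + t) ≤ blockStart n j + 3 ^ n * t := by
  induction t with
  | zero => simp
  | succ t ih =>
    have := blockStart_succ_le n (j + t)
    rw [← add_assoc, mul_add]
    omega

/-- Block starts are relatively dense. -/
theorem exists_blockStart (n i : ℕ) : ∃ j, i ≤ blockStart n j ∧ blockStart n j ≤ i + 3 ^ n := by
  induction i with
  | zero => exact ⟨0, Nat.zero_le _, by simp [blockStart_zero]⟩
  | succ i ih =>
    obtain ⟨j, h1, h2⟩ := ih
    rcases h1.eq_or_lt with h | h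
    · refine ⟨j + 1, ?_, ?_⟩
      · have := strictMono_blockStart n (Nat.lt_succ_self j)
        rw [Nat.succ_eq_add_one] at this
        omega
      · have := blockStart_succ_le n j
        omega
    · exact ⟨j, h, by omega⟩

theorem getElem?_segment_zero {α : Type*} (v : ℕ → α) {i j : ℕ} (h : i < j) :
    (segment v 0 j)[i]? = some (v i) := by
  simp [segment, h]

theorem fixedWord_blockStart_add {n j t : ℕ} {a : Letter}
    (h : ((substitute letterImage)^[n] [fixedWord j])[t]? = some a) :
    fixedWord (blockStart n j + t) = a := by
  have h1 := segment_blockStart_succ n j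
  have ht := (List.getElem?_eq_some_iff.1 h).1
  have h2 := congrArg (fun l : List Letter => l[blockStart n j + t]?) h1
  rw [getElem?_segment_zero _ (by rw [blockStart_succ]; omega),
    List.getElem?_append_right (by simp [length_segment]), length_segment] at h2
  simp only [Nat.sub_zero, Nat.add_sub_cancel_left, h] at h2
  exact Option.some.inj h2

theorem fixedWord_blockStart (n j : ℕ) : fixedWord (blockStart n j) = fixedWord j := by
  obtain ⟨s, hs⟩ := iterate_substitute_letter n (fixedWord j)
  exact fixedWord_blockStart_add (t := 0) (by rw [hs]; rfl)

/-- Modulo `d`, for a suitable power of the morphism, the degree of the prefix preceding a block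
just counts the blocks that are images of `y`. -/
theorem exists_prefixDegree_blockStart (d : ℕ) [NeZero d] :
    ∃ n, ∀ j, (prefixDegree (blockStart n j) : ZMod d) = prefixCount j := by
  obtain ⟨n, hn⟩ := exists_iterate_weightStep d
  refine ⟨n, fun j => ?_⟩
  rw [prefixDegree, ← iterate_substitute_segment, natCast_wordWeight, wordWeight_iterate,
    prefixCount, natCast_wordWeight]
  simp only [Nat.cast_one, Nat.cast_ofNat, Nat.cast_zero, hn]

/-! ### Bounded arithmetic progressions of prefix degrees -/

/-- The image of each letter contains `y`, so `y` occurs in the fixed word with bounded gaps. -/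
theorem exists_eq_y (i : ℕ) : ∃ t < 5, fixedWord (i + t) = Letter.y := by
  obtain ⟨j, h1, h2⟩ := exists_blockStart 1 i
  obtain ⟨s, hs⟩ := Nat.exists_eq_add_of_le h1
  cases hj : fixedWord j with
  | x =>
    refine ⟨s + 1, by omega, ?_⟩
    rw [← add_assoc, ← hs]
    exact fixedWord_blockStart_add (by rw [hj]; rfl)
  | y => exact ⟨s, by omega, by rw [← hs, fixedWord_blockStart, hj]⟩

theorem exists_eq_y_prefixCount (i : ℕ) :
    ∃ t < 5, fixedWord (i + t) = Letter.y ∧ prefixCount (i + t) = prefixCount i := by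
  classical
  -- The first `y` after position `i` is preceded by letters `x` only.
  have hex : ∃ t, fixedWord (i + t) = Letter.y := (exists_eq_y i).imp fun _ h => h.2
  obtain ⟨t, ht, hy⟩ := exists_eq_y i
  refine ⟨Nat.find hex, (Nat.find_min' hex hy).trans_lt ht, Nat.find_spec hex, ?_⟩
  have key : ∀ s ≤ Nat.find hex, prefixCount (i + s) = prefixCount i := by
    intro s hs
    induction s with
    | zero => rfl
    | succ s ih =>
      have hx : fixedWord (i + s) = Letter.x := by
        have := Nat.find_min hex (m := s) (by omega)
        cases h : fixedWord (i + s)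
        · rfl
        · exact absurd h this
      rw [← add_assoc, prefixCount_succ, ih (by omega), hx]
      simp [letterWeight]
  exact key _ le_rfl

theorem exists_eq_y_prefixCount_add (i s : ℕ) : ∃ t < 5 * (s + 1),
    fixedWord (i + t) = Letter.y ∧ prefixCount (i + t) = prefixCount i + s := by
  induction s with
  | zero => simpa using exists_eq_y_prefixCount i
  | succ s ih =>
    obtain ⟨t, ht, hy, hc⟩ := ih
    obtain ⟨t', ht', hy', hc'⟩ := exists_eq_y_prefixCount (i + t + 1)
    refine ⟨t + 1 + t', by omega, ?_, ?_⟩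
    · rw [← hy']; congr 1; omega
    · rw [show i + (t + 1 + t') = i + t + 1 + t' by omega, hc', prefixCount_succ, hc, hy]
      simp [letterWeight, add_assoc]

/-- The degrees of the prefixes of the fixed word do not contain long arithmetic progressions of
difference `d`: the blocks that are images of `y` under a suitable power of the morphism start at
degrees that run through all residues modulo `d`, and each skips the degree following its start. -/
theorem exists_bound_progression (d : ℕ) (hd : 1 ≤ d) :
    ∃ N, ∀ i, ¬ ∀ l ≤ N, ∃ m, prefixDegree m = prefixDegree i + l * d := by
  have : NeZero d := ⟨by omega⟩
  obtain ⟨n, hn⟩ := exists_prefixDegree_blockStart d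
  refine ⟨2 * (3 ^ n + 3 ^ n * (5 * d)) + 1, fun i h => ?_⟩
  obtain ⟨j, hj1, hj2⟩ := exists_blockStart n i
  -- The number of image-of-`y` blocks to pass before one starts at a degree
  -- congruent to `prefixDegree i - 1` modulo `d`.
  set s := ((prefixDegree i : ZMod d) - 1 - prefixCount j).val with hs
  have hsd : s < d := ZMod.val_lt _
  obtain ⟨t, ht, hy, hc⟩ := exists_eq_y_prefixCount_add j s
  set q := blockStart n (j + t) with hq
  have hq1 : i ≤ q := hj1.trans ((strictMono_blockStart n).monotone (Nat.le_add_right j t))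
  have hq2 : q ≤ i + (3 ^ n + 3 ^ n * (5 * d)) := by
    have h1 := blockStart_add_le n j t
    have h2 : 3 ^ n * t ≤ 3 ^ n * (5 * d) := Nat.mul_le_mul_left _ (by omega)
    omega
  have hmod : ((prefixDegree q + 1 : ℕ) : ZMod d) = (prefixDegree i : ℕ) := by
    have h3 : ((s : ℕ) : ZMod d) = (prefixDegree i : ZMod d) - 1 - prefixCount j := by
      rw [hs, ZMod.natCast_val, ZMod.cast_id]
    rw [Nat.cast_add, hq, hn, hc, Nat.cast_add, h3]
    push_cast
    ring
  have hle : prefixDegree i ≤ prefixDegree q := strictMono_prefixDegree.monotone hq1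
  have hdvd : d ∣ prefixDegree q + 1 - prefixDegree i :=
    (Nat.modEq_iff_dvd' (by omega)).1 ((ZMod.natCast_eq_natCast_iff _ _ _).1 hmod.symm)
  obtain ⟨l, hl⟩ := hdvd
  have hlN : l ≤ 2 * (3 ^ n + 3 ^ n * (5 * d)) + 1 := by
    obtain ⟨r, hr⟩ := Nat.exists_eq_add_of_le hq1
    have h4 := prefixDegree_add_le i r
    rw [← hr] at h4
    have h5 : l ≤ d * l := Nat.le_mul_of_pos_left l hd
    omega
  obtain ⟨m, hm⟩ := h l hlN
  refine prefixDegree_ne_of_eq_y (i := q) (by rw [hq, fixedWord_blockStart, hy]) m ?_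
  rw [hm, mul_comm, ← hl]
  omega

section Factorization

variable {α : Type*} {v : ℕ → α} {deg : α → ℕ}

theorem prefixDegree_add_sum_segment (h : ∀ i, deg (v i) = letterWeight (1, 2) (fixedWord i))
    (i t : ℕ) :
    prefixDegree (i + t) = prefixDegree i + ((segment v i (i + t)).map deg).sum := by
  induction t with
  | zero => simp [segment]
  | succ t ih =>
    rw [← add_assoc, prefixDegree_succ, ih,
      ← segment_append v (Nat.le_add_right i t) (Nat.le_succ (i + t)), Nat.succ_eq_add_one,
      segment_succ]
    simp [h, add_assoc]

/-- A word with the degrees of the fixed word does not contain long products of words of the same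
positive degree. -/
theorem exists_bound_flatten (h : ∀ i, deg (v i) = letterWeight (1, 2) (fixedWord i)) (d : ℕ)
    (hd : 1 ≤ d) : ∃ N, ∀ L : List (List α), N ≤ L.length → (∀ u ∈ L, (u.map deg).sum = d) →
      ¬ IsSubword L.flatten v := by
  obtain ⟨N, hN⟩ := exists_bound_progression d hd
  refine ⟨N, fun L hL hdeg ⟨i, j, hij⟩ => hN i fun l hl => ?_⟩
  refine ⟨i + (L.take l).flatten.length, ?_⟩
  have h1 : (L.take l).flatten ++ (L.drop l).flatten = segment v i j := by
    rw [← List.flatten_append, List.take_append_drop, hij]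
  rw [prefixDegree_add_sum_segment h, ← eq_segment_of_append v h1, List.map_flatten,
    List.sum_flatten, List.map_map]
  congr 1
  rw [List.map_congr_left (f := List.sum ∘ List.map deg) (g := fun _ => d) fun u hu => hdeg u (List.mem_of_mem_take hu)]
  simp [Nat.min_eq_left (hl.trans hL)]

end Factorization

/-! ### Universal gap sequences -/

/-- A sequence of natural numbers that contains every finite list as a block: the list with code
`c` is written at the positions from `c ^ 2` on, which are free up to `(c + 1) ^ 2`. -/
def universalSequence (i : ℕ) : ℕ :=
  ((Encodable.decode (α := List ℕ) i.sqrt).getD []).getD (i - i.sqrt * i.sqrt) 0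

theorem exists_universalSequence_eq (a : List ℕ) :
    ∃ m, ∀ (j : ℕ) (hj : j < a.length), universalSequence (m + j) = a[j] := by
  refine ⟨Encodable.encode a * Encodable.encode a, fun j hj => ?_⟩
  have h1 : j ≤ Encodable.encode a := hj.le.trans (Encodable.length_le_encode a)
  rw [universalSequence, Nat.sqrt_add_eq _ (by omega), Encodable.encodek]
  simp [hj]

theorem exists_hasUniversalGaps : ∃ n : ℕ → ℕ, HasUniversalGaps n := by
  refine ⟨fun i => ∑ t ∈ Finset.range i, max 1 (universalSequence t), by simp, ?_, ?_⟩
  · refine strictMono_nat_of_lt_succ fun i => ?_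
    rw [Finset.sum_range_succ]
    have : 1 ≤ max 1 (universalSequence i) := le_max_left _ _
    omega
  · intro a ha
    obtain ⟨m, hm⟩ := exists_universalSequence_eq a
    refine ⟨m, fun j hj => ?_⟩
    rw [Finset.sum_range_succ, hm j hj, max_eq_right (ha _ (List.getElem_mem hj))]

/-! ### The grading of a monomial algebra -/

section Monomial

variable (k : Type*) [Field k] {α : Type*} (F : Set (List α)) (deg : α → ℕ)

theorem monomialOf_nil : monomialOf k F [] = 1 := by
  simp [monomialOf, freeMonomial]

theorem monomialOf_append (u v : List α) :
    monomialOf k F (u ++ v) = monomialOf k F u * monomialOf k F v := by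
  simp [monomialOf, freeMonomial]

theorem monomialOf_eq_zero {u : List α} (hu : u ∈ F) : monomialOf k F u = 0 := by
  rw [monomialOf, RingQuot.mkAlgHom_rel k (MonomialRel.of u hu), map_zero]

theorem map_freeMonomial {A : Type*} [Semiring A] [Algebra k A] (f : α → A) (u : List α) :
    FreeAlgebra.lift k f (freeMonomial k u) = (u.map f).prod := by
  simp [freeMonomial, map_list_prod, Function.comp_def]

theorem adjoin_range_monomialOf :
    Algebra.adjoin k (Set.range fun a => monomialOf k F [a]) = ⊤ := by
  have h : (fun a => monomialOf k F [a]) =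
      RingQuot.mkAlgHom k (MonomialRel k F) ∘ FreeAlgebra.ι k := by
    funext a
    simp [monomialOf, freeMonomial]
  rw [h, Set.range_comp, ← AlgHom.map_adjoin, FreeAlgebra.adjoin_range_ι, Algebra.map_top,
    AlgHom.range_eq_top]
  exact RingQuot.mkAlgHom_surjective k _

theorem monomialOf_mem_monomialGrading (u : List α) :
    monomialOf k F u ∈ monomialGrading k F deg (u.map deg).sum :=
  Submodule.subset_span ⟨u, rfl, rfl⟩

instance gradedMonoid_monomialGrading : SetLike.GradedMonoid (monomialGrading k F deg) where
  one_mem := by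
    rw [← monomialOf_nil k F]
    exact monomialOf_mem_monomialGrading k F deg []
  mul_mem := by
    intro i j a b ha hb
    have h : monomialGrading k F deg i * monomialGrading k F deg j ≤
        monomialGrading k F deg (i + j) := by
      rw [monomialGrading, monomialGrading, Submodule.span_mul_span, Submodule.span_le]
      rintro _ ⟨_, ⟨u, rfl, rfl⟩, _, ⟨v, rfl, rfl⟩, rfl⟩
      refine Submodule.subset_span ⟨u ++ v, by simp, ?_⟩
      exact (monomialOf_append k F u v).symm
    exact h (Submodule.mul_mem_mul ha hb)

/-- A monomial as an element of the direct sum of the homogeneous components. -/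
noncomputable def homogeneousMonomial (u : List α) :
    DirectSum ℕ fun d => monomialGrading k F deg d :=
  DirectSum.of (fun d => monomialGrading k F deg d) (u.map deg).sum
    ⟨monomialOf k F u, monomialOf_mem_monomialGrading k F deg u⟩

theorem lift_homogeneousMonomial (u : List α) :
    FreeAlgebra.lift k (fun a => homogeneousMonomial k F deg [a]) (freeMonomial k u) =
      homogeneousMonomial k F deg u := by
  rw [map_freeMonomial]
  induction u with
  | nil =>
    refine DirectSum.of_eq_of_gradedMonoid_eq (Sigma.subtype_ext rfl ?_)
    exact (monomialOf_nil k F).symm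
  | cons a u ih =>
    rw [List.map_cons, List.prod_cons, ih, homogeneousMonomial, homogeneousMonomial,
      DirectSum.of_mul_of]
    refine DirectSum.of_eq_of_gradedMonoid_eq (Sigma.subtype_ext ?_ ?_)
    · rfl
    · exact (monomialOf_append k F [a] u).symm

/-- The decomposition of a monomial algebra into homogeneous components, as a homomorphism of
algebras; it exists because the relations are homogeneous. -/
noncomputable def decomposeMonomial :
    MonomialAlgebra k F →ₐ[k] DirectSum ℕ fun d => monomialGrading k F deg d :=
  RingQuot.liftAlgHom k ⟨FreeAlgebra.lift k fun a => homogeneousMonomial k F deg [a], by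
    rintro _ _ ⟨u, hu⟩
    rw [map_zero, lift_homogeneousMonomial, homogeneousMonomial]
    have h : (⟨monomialOf k F u, monomialOf_mem_monomialGrading k F deg u⟩ :
        monomialGrading k F deg (u.map deg).sum) = 0 := Subtype.ext (monomialOf_eq_zero k F hu)
    rw [h, map_zero]⟩

theorem decomposeMonomial_monomialOf (u : List α) :
    decomposeMonomial k F deg (monomialOf k F u) = homogeneousMonomial k F deg u := by
  rw [decomposeMonomial, monomialOf, RingQuot.liftAlgHom_mkAlgHom_apply, lift_homogeneousMonomial]

theorem nonempty_gradedAlgebra_monomialGrading :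
    Nonempty (GradedAlgebra (monomialGrading k F deg)) := by
  refine ⟨GradedAlgebra.ofAlgHom _ (decomposeMonomial k F deg) ?_ ?_⟩
  · refine RingQuot.ringQuot_ext' k _ _ (FreeAlgebra.hom_ext (funext fun a => ?_))
    have h : RingQuot.mkAlgHom k (MonomialRel k F) (FreeAlgebra.ι k a) = monomialOf k F [a] := by
      simp [monomialOf, freeMonomial]
    simp only [Function.comp_apply, AlgHom.comp_apply, h, decomposeMonomial_monomialOf,
      homogeneousMonomial, DirectSum.coeAlgHom_of, AlgHom.id_apply]
  · rintro d ⟨a, ha⟩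
    change decomposeMonomial k F deg a = _
    induction ha using Submodule.span_induction with
    | mem a h =>
      obtain ⟨u, rfl, rfl⟩ := h
      exact decomposeMonomial_monomialOf k F deg u
    | zero => rw [map_zero]; exact (map_zero _).symm
    | add a b ha hb iha ihb => rw [map_add, iha, ihb, ← map_add]; rfl
    | smul c a ha iha => rw [map_smul, iha, ← DirectSum.of_smul]; rfl

/-! ### Graded nilpotence -/

/-- The span of the products of at least `N` monomials of degree `d`. -/
def productSpan (d N : ℕ) : Submodule k (MonomialAlgebra k F) :=
  Submodule.span k {a | ∃ L : List (List α), N ≤ L.length ∧ (∀ u ∈ L, (u.map deg).sum = d) ∧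
    a = monomialOf k F L.flatten}

theorem productSpan_mul_le (d M N : ℕ) :
    productSpan k F deg d M * productSpan k F deg d N ≤ productSpan k F deg d (M + N) := by
  rw [productSpan, productSpan, Submodule.span_mul_span, Submodule.span_le]
  rintro _ ⟨_, ⟨L, hL, hL', rfl⟩, _, ⟨L₂, hL₂, hL₂', rfl⟩, rfl⟩
  refine Submodule.subset_span ⟨L ++ L₂, ?_, ?_, ?_⟩
  · rw [List.length_append]; omega
  · intro u hu
    exact (List.mem_append.1 hu).elim (hL' u) (hL₂' u)
  · rw [List.flatten_append, monomialOf_append]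

theorem productSpan_anti (d : ℕ) {M N : ℕ} (h : M ≤ N) :
    productSpan k F deg d N ≤ productSpan k F deg d M :=
  Submodule.span_mono fun _ ⟨L, hL, h'⟩ => ⟨L, h.trans hL, h'⟩

theorem productSpan_pow_le (d N : ℕ) :
    productSpan k F deg d 1 ^ N ≤ productSpan k F deg d N := by
  induction N with
  | zero =>
    rw [pow_zero, Submodule.one_le]
    exact Submodule.subset_span ⟨[], by simp, by simp, (monomialOf_nil k F).symm⟩
  | succ N ih =>
    rw [pow_succ]
    exact (mul_le_mul' ih le_rfl).trans (productSpan_mul_le k F deg d N 1)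

theorem adjoin_le_productSpan {d : ℕ} {S : Set (MonomialAlgebra k F)}
    (hS : S ⊆ monomialGrading k F deg d) :
    (NonUnitalAlgebra.adjoin k S).toSubmodule ≤ productSpan k F deg d 1 := by
  intro a ha
  change a ∈ NonUnitalAlgebra.adjoin k S at ha
  induction ha using NonUnitalAlgebra.adjoin_induction with
  | mem a h =>
    refine Submodule.span_mono ?_ (hS h)
    rintro _ ⟨u, hu, rfl⟩
    exact ⟨[u], by simp, by simpa using hu, by simp⟩
  | add a b _ _ iha ihb => exact add_mem iha ihb
  | zero => exact zero_mem _
  | mul a b _ _ iha ihb =>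
    exact productSpan_anti k F deg d one_le_two
      (productSpan_mul_le k F deg d 1 1 (Submodule.mul_mem_mul iha ihb))
  | smul c a _ iha => exact Submodule.smul_mem _ c iha

/-- If long products of words of the same positive degree are forbidden, the positive part of the
monomial algebra is graded nilpotent. -/
theorem positivePartIsGradedNilpotent_of_bound
    (h : ∀ d, 1 ≤ d → ∃ N, ∀ L : List (List α), N ≤ L.length →
      (∀ u ∈ L, (u.map deg).sum = d) → L.flatten ∈ F) :
    PositivePartIsGradedNilpotent (monomialGrading k F deg) := by
  intro d hd S hS
  obtain ⟨N, hN⟩ := h d hd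
  refine ⟨N, ?_⟩
  rw [Submodule.zero_eq_bot, eq_bot_iff]
  refine (pow_le_pow_left' (adjoin_le_productSpan k F deg hS) N).trans
    ((productSpan_pow_le k F deg d N).trans (Submodule.span_le.2 ?_))
  rintro _ ⟨L, hL, hL', rfl⟩
  exact monomialOf_eq_zero k F (hN L hL hL')

end Monomial

/-! ### Free subalgebras of the monomial algebra of a word -/

section Free

variable (k : Type*) [Field k] {α : Type*} (v : ℕ → α)

open Classical in
/-- The operator of left multiplication by the letter `a` in the monomial algebra of the word `v`,
extended to infinite sums: a function on words stands for its formal sum of monomials. -/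
noncomputable def letterAction (a : α) : Module.End k (List α → k) where
  toFun f
    | [] => 0
    | b :: u => if b = a ∧ IsSubword (b :: u) v then f u else 0
  map_add' f g := by
    funext w
    cases w with
    | nil => simp
    | cons b u => simp only [Pi.add_apply]; split_ifs <;> simp
  map_smul' c f := by
    funext w
    cases w with
    | nil => simp
    | cons b u => simp

open Classical in
theorem letterAction_cons (a b : α) (f : List α → k) (u : List α) :
    letterAction k v a f (b :: u) = if b = a ∧ IsSubword (b :: u) v then f u else 0 := rfl

theorem letterAction_nil (a : α) (f : List α → k) : letterAction k v a f [] = 0 := rfl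

theorem prefix_of_prod_letterAction_ne_zero (u : List α) (f : List α → k) (w : List α)
    (h : (u.map (letterAction k v)).prod f w ≠ 0) : u <+: w ∧ (u ≠ [] → IsSubword w v) := by
  classical
  induction u generalizing w with
  | nil => exact ⟨List.nil_prefix, fun h => absurd rfl h⟩
  | cons a u ih =>
    rw [List.map_cons, List.prod_cons, Module.End.mul_apply] at h
    cases w with
    | nil => exact absurd (letterAction_nil k v a _) h
    | cons b w =>
      rw [letterAction_cons] at h
      obtain ⟨⟨rfl, hs⟩, h'⟩ := ite_ne_right_iff.1 h
      exact ⟨(List.prefix_cons_inj _).2 (ih w h').1, fun _ => hs⟩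

/-- The action of the monomial algebra of the word `v` on functions on words. -/
noncomputable def wordAction :
    MonomialAlgebra k (nonSubwords v) →ₐ[k] Module.End k (List α → k) :=
  RingQuot.liftAlgHom k ⟨FreeAlgebra.lift k (letterAction k v), by
    rintro _ _ ⟨u, hu⟩
    rw [map_zero, map_freeMonomial]
    refine LinearMap.ext fun f => funext fun w => ?_
    by_contra h
    obtain ⟨⟨s, rfl⟩, h2⟩ := prefix_of_prod_letterAction_ne_zero k v u f w h
    by_cases hu' : u = []
    · exact hu (hu' ▸ IsSubword.nil v)
    · exact hu (IsSubword.of_append_left v (h2 hu'))⟩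

theorem wordAction_monomialOf_singleton (a : α) :
    wordAction k v (monomialOf k (nonSubwords v) [a]) = letterAction k v a := by
  rw [wordAction, monomialOf, RingQuot.liftAlgHom_mkAlgHom_apply, map_freeMonomial]
  simp

theorem basisFreeMonoid_ofList {κ : Type*} (L : List κ) :
    FreeAlgebra.basisFreeMonoid k κ (FreeMonoid.ofList L) = freeMonomial k L := by
  simp [FreeAlgebra.basisFreeMonoid, freeMonomial, FreeAlgebra.equivMonoidAlgebraFreeMonoid,
    MonoidAlgebra.lift_apply]

variable {κ : Type*} [DecidableEq κ] (c : α → κ) (S : κ → Finset α)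

/-- Suppose the letters are coloured by `c`, with finite colour classes.  A product of sums over
colour classes is the sum of the monomials with the given colour pattern. -/
theorem prod_sum_letterAction (hS : ∀ i a, a ∈ S i ↔ c a = i) (L : List κ) (w : List α)
    (hw : IsSubword w v) :
    (L.map fun i => ∑ a ∈ S i, letterAction k v a).prod (fun u => if u = [] then 1 else 0) w =
      if w.map c = L then 1 else 0 := by
  classical
  induction L generalizing w with
  | nil => simp
  | cons i L ih =>
    rw [List.map_cons, List.prod_cons, Module.End.mul_apply, LinearMap.sum_apply,
      Finset.sum_apply]
    cases w with
    | nil => simp [letterAction_nil]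
    | cons b w =>
      have hw' : IsSubword w v := IsSubword.of_append v (u := [b]) hw
      simp only [letterAction_cons, hw, and_true, ih w hw', Finset.sum_ite_eq, hS,
        List.map_cons, List.cons.injEq, ite_and]

/-- If every colour pattern is realized by a subword of `v`, then the sums of the generators over
the colour classes generate a free algebra: products of such sums are supported on disjoint sets
of monomials. -/
theorem injective_lift_sum_monomialOf (hS : ∀ i a, a ∈ S i ↔ c a = i)
    (h : ∀ L : List κ, ∃ w, IsSubword w v ∧ w.map c = L) :
    Function.Injective (FreeAlgebra.lift k
      (fun i => ∑ a ∈ S i, monomialOf k (nonSubwords v) [a]) :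
        FreeAlgebra k κ →ₐ[k] MonomialAlgebra k (nonSubwords v)) := by
  choose W hW hWc using h
  set φ := FreeAlgebra.lift k (fun i => ∑ a ∈ S i, monomialOf k (nonSubwords v) [a]) with hφ
  -- The coefficient of `p` at a pattern `L` is read off at the chosen subword with this pattern.
  have key : ∀ (p : FreeAlgebra k κ) (L : List κ),
      wordAction k v (φ p) (fun u => if u = [] then 1 else 0) (W L) =
        (FreeAlgebra.basisFreeMonoid k κ).repr p (FreeMonoid.ofList L) := by
    intro p L
    let ψ₁ : FreeAlgebra k κ →ₗ[k] k :=
      LinearMap.proj (W L) ∘ₗ LinearMap.applyₗ (fun u => if u = [] then 1 else 0) ∘ₗ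
        ((wordAction k v).comp φ).toLinearMap
    let ψ₂ : FreeAlgebra k κ →ₗ[k] k :=
      (FreeAlgebra.basisFreeMonoid k κ).coord (FreeMonoid.ofList L)
    suffices hψ : ψ₁ = ψ₂ from LinearMap.congr_fun hψ p
    refine (FreeAlgebra.basisFreeMonoid k κ).ext fun M => ?_
    obtain ⟨L', rfl⟩ := FreeMonoid.ofList.surjective M
    have h1 : ψ₂ (FreeAlgebra.basisFreeMonoid k κ (FreeMonoid.ofList L')) = if L = L' then 1 else 0 := by
      change (FreeAlgebra.basisFreeMonoid k κ).repr _ (FreeMonoid.ofList L) = _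
      rw [Module.Basis.repr_self]
      by_cases hL : L = L'
      · rw [if_pos hL, hL, Finsupp.single_eq_same]
      · rw [if_neg hL, Finsupp.single_eq_of_ne (FreeMonoid.ofList.injective.ne hL)]
    have h2 : wordAction k v (φ (freeMonomial k L')) =
        (L'.map fun i => ∑ a ∈ S i, letterAction k v a).prod := by
      rw [hφ, map_freeMonomial, map_list_prod, List.map_map]
      congr 1
      refine List.map_congr_left fun i _ => ?_
      simp [map_sum, wordAction_monomialOf_singleton]
    rw [h1]
    change wordAction k v (φ (FreeAlgebra.basisFreeMonoid k κ (FreeMonoid.ofList L')))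
      (fun u => if u = [] then 1 else 0) (W L) = _
    rw [basisFreeMonoid_ofList, h2, prod_sum_letterAction k v c S hS _ _ (hW L), hWc]
  rw [injective_iff_map_eq_zero]
  intro p hp
  refine (FreeAlgebra.basisFreeMonoid k κ).repr.map_eq_zero_iff.1 (Finsupp.ext fun L => ?_)
  rw [← FreeMonoid.ofList_toList L, ← key p, hp, map_zero]
  rfl

end Free

/-! ### Colour patterns of the spliced word -/

/-- The colour of a letter: `0` for `x, y` and `1` for `x', y'`. -/
def letterColour : Alphabet → Fin 2
  | Alphabet.x => 0
  | Alphabet.y => 0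
  | Alphabet.xPrime => 1
  | Alphabet.yPrime => 1

/-- The colour of the letters of block number `m` of the spliced word. -/
def blockColour (m : ℕ) : Fin 2 :=
  if Even m then 0 else 1

/-- The colour pattern consisting of blocks of alternating colours, starting with colour `i`, with
the given lengths. -/
def expandBlocks (i : Fin 2) : List ℕ → List (Fin 2)
  | [] => []
  | t :: a => List.replicate t i ++ expandBlocks i.rev a

theorem rev_eq_of_ne : ∀ {i j : Fin 2}, i ≠ j → i.rev = j := by decide

theorem blockColour_succ (m : ℕ) : blockColour (m + 1) = (blockColour m).rev := by
  unfold blockColour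
  by_cases h : Even m
  · rw [if_pos h, if_neg (by rwa [Nat.even_add_one, not_not])]; rfl
  · rw [if_neg h, if_pos (by rwa [Nat.even_add_one])]; rfl

theorem map_letterColour_block {n : ℕ → ℕ} (hn : StrictMono n) (m : ℕ) :
    (segment (splicedWord n) (n m) (n (m + 1))).map letterColour =
      List.replicate (n (m + 1) - n m) (blockColour m) := by
  have h0 : ∀ a, letterColour (unprimed a) = 0 := fun a => by cases a <;> rfl
  have h1 : ∀ a, letterColour (primed a) = 1 := fun a => by cases a <;> rfl
  rw [splicedWord, segment_splice hn, blockColour]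
  split_ifs <;> simp [segment, Function.comp_def, h0, h1]

theorem map_letterColour_segment {n : ℕ → ℕ} (hn : StrictMono n) (a : List ℕ) (m : ℕ)
    (h : ∀ (j : ℕ) (hj : j < a.length), n (m + j + 1) = n (m + j) + a[j]) :
    (segment (splicedWord n) (n m) (n (m + a.length))).map letterColour =
      expandBlocks (blockColour m) a := by
  induction a generalizing m with
  | nil => simp [segment, expandBlocks]
  | cons t a ih =>
    have ht : n (m + 1) = n m + t := h 0 (by simp)
    have h' : ∀ (j : ℕ) (hj : j < a.length), n (m + 1 + j + 1) = n (m + 1 + j) + a[j] := by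
      intro j hj
      have := h (j + 1) (by simpa using hj)
      rwa [List.getElem_cons_succ, show m + (j + 1) = m + 1 + j by omega] at this
    have hlen : m + (t :: a).length = m + 1 + a.length := by rw [List.length_cons]; omega
    rw [hlen, ← segment_append (splicedWord n) (hn.monotone (Nat.le_succ m))
      (hn.monotone (Nat.le_add_right (m + 1) a.length)), List.map_append, Nat.succ_eq_add_one,
      ih (m + 1) h', map_letterColour_block hn, blockColour_succ, expandBlocks, ht,
      Nat.add_sub_cancel_left]

theorem exists_expandBlocks_eq (L : List (Fin 2)) (i : Fin 2) :
    ∃ a : List ℕ, (∀ t ∈ a, 0 < t) ∧ expandBlocks i a = i :: L := by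
  induction L generalizing i with
  | nil => exact ⟨[1], by simp, rfl⟩
  | cons j L ih =>
    obtain ⟨a, ha, h⟩ := ih j
    by_cases hij : j = i
    · subst hij
      cases a with
      | nil => simp [expandBlocks] at h
      | cons t a =>
        refine ⟨(t + 1) :: a, ?_, ?_⟩
        · simp only [List.mem_cons, forall_eq_or_imp] at ha ⊢
          exact ⟨t.succ_pos, ha.2⟩
        · rw [expandBlocks, List.replicate_succ, List.cons_append, ← h, expandBlocks]
    · refine ⟨1 :: a, by simpa using ha, ?_⟩
      rw [expandBlocks, rev_eq_of_ne (Ne.symm hij), h]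
      rfl

/-- A list of gaps occurs in a universal sequence from an index of either parity: it suffices to
realize a list that contains it twice, at an odd distance. -/
theorem HasUniversalGaps.exists_blockColour_eq {n : ℕ → ℕ} (hn : HasUniversalGaps n)
    (a : List ℕ) (ha : ∀ t ∈ a, 0 < t) (i : Fin 2) :
    ∃ m, blockColour m = i ∧
      ∀ (j : ℕ) (hj : j < a.length), n (m + j + 1) = n (m + j) + a[j] := by
  obtain ⟨m, hm⟩ := hn.realizes (a ++ (List.replicate (a.length + 1) 1 ++ a)) (by
    intro t ht
    simp only [List.mem_append, List.mem_replicate] at ht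
    rcases ht with h | h | h
    · exact ha t h
    · omega
    · exact ha t h)
  simp only [List.length_append, List.length_replicate] at hm
  by_cases h : blockColour m = i
  · refine ⟨m, h, fun j hj => ?_⟩
    rw [hm j (by omega), List.getElem_append_left hj]
  · refine ⟨m + (2 * a.length + 1), ?_, fun j hj => ?_⟩
    · rw [← add_assoc, blockColour_succ]
      have h2 : blockColour (m + 2 * a.length) = blockColour m := by
        simp [blockColour, Nat.even_add]
      rw [h2, rev_eq_of_ne h]
    · have := hm (2 * a.length + 1 + j) (by omega)
      rw [List.getElem_append_right (by omega), List.getElem_append_right (by simp; omega)] at this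
      rw [show m + (2 * a.length + 1) + j = m + (2 * a.length + 1 + j) by omega, this]
      congr 2
      simp only [List.length_replicate]
      omega

/-- Every colour pattern is realized by a subword of the spliced word. -/
theorem exists_isSubword_splicedWord {n : ℕ → ℕ} (hn : HasUniversalGaps n) (L : List (Fin 2)) :
    ∃ w, IsSubword w (splicedWord n) ∧ w.map letterColour = L := by
  cases L with
  | nil => exact ⟨[], IsSubword.nil _, rfl⟩
  | cons i L =>
    obtain ⟨a, ha, h⟩ := exists_expandBlocks_eq L i
    obtain ⟨m, hm, hgap⟩ := hn.exists_blockColour_eq a ha i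
    exact ⟨_, ⟨_, _, rfl⟩, by rw [map_letterColour_segment hn.strictMono a m hgap, hm, h]⟩

theorem letterDegree_splicedWord (n : ℕ → ℕ) (i : ℕ) :
    letterDegree (splicedWord n i) = letterWeight (1, 2) (fixedWord i) := by
  have h0 : ∀ a, letterDegree (unprimed a) = letterWeight (1, 2) a := fun a => by cases a <;> rfl
  have h1 : ∀ a, letterDegree (primed a) = letterWeight (1, 2) a := fun a => by cases a <;> rfl
  unfold splicedWord splice
  split_ifs
  · exact h0 _
  · exact h1 _

/-! ### The monomial algebra of the spliced word, up to renaming of the letters -/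

section Renaming

variable (k : Type*) [Field k] {α : Type*} (e : Alphabet ≃ α) {n : ℕ → ℕ}

theorem positivePartIsGradedNilpotent_splicedWord (n : ℕ → ℕ) :
    PositivePartIsGradedNilpotent (monomialGrading k (nonSubwords fun i => e (splicedWord n i))
      fun a => letterDegree (e.symm a)) :=
  positivePartIsGradedNilpotent_of_bound k _ _ <| exists_bound_flatten fun i => by
    rw [e.symm_apply_apply, letterDegree_splicedWord]

theorem generateFreeSubalgebra_splicedWord (hn : HasUniversalGaps n) :
    GenerateFreeSubalgebra k
      (monomialOf k (nonSubwords fun i => e (splicedWord n i)) [e Alphabet.x] +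
        monomialOf k (nonSubwords fun i => e (splicedWord n i)) [e Alphabet.y])
      (monomialOf k (nonSubwords fun i => e (splicedWord n i)) [e Alphabet.xPrime] +
        monomialOf k (nonSubwords fun i => e (splicedWord n i)) [e Alphabet.yPrime]) := by
  classical
  let S : Fin 2 → Finset α :=
    ![{e Alphabet.x, e Alphabet.y}, {e Alphabet.xPrime, e Alphabet.yPrime}]
  let g : α → MonomialAlgebra k (nonSubwords fun i => e (splicedWord n i)) :=
    fun a => monomialOf k _ [a]
  have hS : ∀ i a, a ∈ S i ↔ letterColour (e.symm a) = i := by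
    intro i a
    obtain ⟨b, rfl⟩ := e.surjective a
    fin_cases i <;> cases b <;> simp [S, letterColour]
  have hsub : ∀ L : List (Fin 2), ∃ w, IsSubword w (fun i => e (splicedWord n i)) ∧
      w.map (fun a => letterColour (e.symm a)) = L := by
    intro L
    obtain ⟨w, ⟨i, j, hw⟩, hL⟩ := exists_isSubword_splicedWord hn L
    refine ⟨w.map e, ⟨i, j, ?_⟩, ?_⟩
    · rw [hw, map_segment]
    · rw [List.map_map, ← hL]
      exact List.map_congr_left fun a _ => by simp
  have h := injective_lift_sum_monomialOf k _ _ S hS hsub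
  rw [GenerateFreeSubalgebra]
  convert h using 3
  funext i
  fin_cases i
  · have hne : e Alphabet.x ≠ e Alphabet.y := e.injective.ne nofun
    exact (Finset.sum_pair (f := g) hne).symm
  · have hne : e Alphabet.xPrime ≠ e Alphabet.yPrime := e.injective.ne nofun
    exact (Finset.sum_pair (f := g) hne).symm

end Renaming

/-- A numbering of the four letters. -/
def alphabetEquiv : Alphabet ≃ Fin 4 where
  toFun
    | Alphabet.x => 0
    | Alphabet.y => 1
    | Alphabet.xPrime => 2
    | Alphabet.yPrime => 3
  invFun := ![Alphabet.x, Alphabet.y, Alphabet.xPrime, Alphabet.yPrime]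
  left_inv a := by cases a <;> rfl
  right_inv i := by fin_cases i <;> rfl

end FreeSubalgebra

theorem mainTheorem1 (k : Type*) [Field k] :
    (∃ n : ℕ → ℕ, HasUniversalGaps n) ∧
    (∀ n : ℕ → ℕ, HasUniversalGaps n →
      Nonempty (GradedAlgebra
        (monomialGrading k (nonSubwords (splicedWord n)) letterDegree)) ∧
      PositivePartIsGradedNilpotent
        (monomialGrading k (nonSubwords (splicedWord n)) letterDegree) ∧
      GenerateFreeSubalgebra k
        (monomialOf k (nonSubwords (splicedWord n)) [Alphabet.x] +
          monomialOf k (nonSubwords (splicedWord n)) [Alphabet.y])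
        (monomialOf k (nonSubwords (splicedWord n)) [Alphabet.xPrime] +
          monomialOf k (nonSubwords (splicedWord n)) [Alphabet.yPrime])) ∧
    (∃ (r : ℕ) (F : Set (List (Fin r))) (deg : Fin r → ℕ),
      (∀ i, deg i = 1 ∨ deg i = 2) ∧
      Nonempty (GradedAlgebra (monomialGrading k F deg)) ∧
      Algebra.FiniteType k (MonomialAlgebra k F) ∧
      Algebra.adjoin k ((monomialGrading k F deg 1 : Set (MonomialAlgebra k F)) ∪
        (monomialGrading k F deg 2 : Set (MonomialAlgebra k F))) = ⊤ ∧
      PositivePartIsGradedNilpotent (monomialGrading k F deg) ∧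
      ∃ a b : MonomialAlgebra k F,
        a ∈ ⨆ d ≥ 1, monomialGrading k F deg d ∧
        b ∈ ⨆ d ≥ 1, monomialGrading k F deg d ∧
        GenerateFreeSubalgebra k a b) := by
  refine ⟨exists_hasUniversalGaps, fun n hn => ⟨nonempty_gradedAlgebra_monomialGrading k _ _,
    positivePartIsGradedNilpotent_splicedWord k (Equiv.refl _) n,
    generateFreeSubalgebra_splicedWord k (Equiv.refl _) hn⟩, ?_⟩
  obtain ⟨n, hn⟩ := exists_hasUniversalGaps
  set F := nonSubwords fun i => alphabetEquiv (splicedWord n i)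
  set deg : Fin 4 → ℕ := fun a => letterDegree (alphabetEquiv.symm a)
  have hdeg12 : ∀ i, deg i = 1 ∨ deg i = 2 := fun i => by
    fin_cases i
    exacts [Or.inl rfl, Or.inr rfl, Or.inl rfl, Or.inr rfl]
  have hmem : ∀ i, monomialOf k F [i] ∈ monomialGrading k F deg (deg i) := fun i => by
    simpa using monomialOf_mem_monomialGrading k F deg [i]
  have hpos : ∀ i, monomialOf k F [i] ∈ ⨆ d ≥ 1, monomialGrading k F deg d := fun i =>
    Submodule.mem_iSup_of_mem (deg i) (Submodule.mem_iSup_of_mem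
      (by rcases hdeg12 i with h | h <;> omega) (hmem i))
  refine ⟨4, F, deg, hdeg12, nonempty_gradedAlgebra_monomialGrading k F deg,
    Algebra.FiniteType.of_surjective (RingQuot.mkAlgHom k (MonomialRel k F))
      (RingQuot.mkAlgHom_surjective k _), ?_,
    positivePartIsGradedNilpotent_splicedWord k alphabetEquiv n,
    _, _, add_mem (hpos _) (hpos _), add_mem (hpos _) (hpos _),
    generateFreeSubalgebra_splicedWord k alphabetEquiv hn⟩
  rw [eq_top_iff, ← adjoin_range_monomialOf k F]
  refine Algebra.adjoin_mono ?_
  rintro _ ⟨i, rfl⟩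
  rcases hdeg12 i with h | h
  · exact Or.inl (h ▸ hmem i)
  · exact Or.inr (h ▸ hmem i)
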